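/- Let $\lambda=(\lambda_1\ge\dots\ge\lambda_N\ge 1)$ be a partition, identified with its Young diagram, the set of boxes $(i,j)$ with $1\le i\le N$ (row, counted from the top) and $1\le j\le\lambda_i$ (column). Let $\lambda'_b$ be the number of boxes in column $b$, and let $\lambda^*$ be the extended diagram with rows $\lambda^*_1=\lambda_1+1$ and $\lambda^*_i=\lambda_{i-1}+1$ for $2\le i\le N+1$. For $(a,b)\in\lambda^*$ let $n_{a,b}\ge 1$ be the largest $n$ such that all boxes $(a+i-1,b+j-1)$, $1\le i,j\le n$, lie in $\lambda^*$. Fix non-zero elements $\theta_{i,j}$, $(i,j)\in\lambda^*$, of a field. Then the system $$\det\big(p_{a+i-1,\,b+j-1}\big)_{1\le i,j\le n_{a,b}}=\theta_{a,b}\qquad\text{for all }(a,b)\in\lambda^*$$ has a unique solution $(p_{a,b})_{(a,b)\in\lambda^*}$. For every $(a,b)\in\lambda$ it is given by $$p_{a,b}=\theta_{a,\lambda_a+1}\sum_{P}\ \prod_{e\in P}w(e),$$ where $P$ runs over the (finitely many) oriented paths from the leftmost to the rightmost vertex of the following weighted oriented network $\mathcal N_{a,b}$. Let $\lambda_{a,b}$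 be the set of boxes $(i,j)\in\lambda$ with $i\ge a$ and $j\ge b$. The vertices and edges of $\mathcal N_{a,b}$ are the corners and sides of the boxes of $\lambda_{a,b}$. Write $[r,c]$ for the north-west corner of the box position $(r,c)$, so that the box $(r,c)$ has corners $[r,c]$, $[r,c+1]$, $[r+1,c]$, $[r+1,c+1]$. The diagram is tilted by $45^\circ$ so that its north-west corner is on top, and edges are oriented from left to right: horizontal sides go $[r,c]\to[r,c+1]$ and vertical sides go $[r+1,c]\to[r,c]$. The leftmost vertex is the south-west corner $[\lambda'_b+1,b]$ of $\lambda_{a,b}$, and the rightmost vertex is its north-east corner $[a,\lambda_a+1]$. With the convention $\theta_{i,j}=1$ for $(i,j)\notin\lambda^*$, the edge weights are $$w\big([r,c]\to[r,c+1]\big)=\frac{\theta_{r,c}}{\theta_{r,c+1}},\qquad w\big([r+1,c]\to[r,c]\big)=\frac{\theta_{r+2,c+1}}{\theta_{r+1,c+1}}.$$ (That is, $\theta_{i,j}$ is the variable of the face at box position $(i-1,j-1)$, the remaining faces carry the variable $1$, and the weight of an edge is the ratio of the variables of the faces directly above, for a horizontal side, or directly below, for a vertical side, its left and right end points in the tilted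 picture.) -/

import Mathlib

/-! Boxes of a Young diagram are indexed from `0` as in Mathlib: the box in row `a` and column `b`
(counted from `1`) is `(a - 1, b - 1)`. -/

namespace YoungNetwork

/-- The row lengths of the extended diagram `μ*`: the first row has `μ₁ + 1` boxes and, for every
row of `μ`, the next row of `μ*` has one box more than this row of `μ`. -/
def starRowLen (μ : YoungDiagram) : ℕ → ℕ
  | 0 => μ.rowLen 0 + 1
  | i + 1 => if i < μ.colLen 0 then μ.rowLen i + 1 else 0

/-- The extended diagram `μ*`, obtained from `μ` by adjoining a border strip from the end of the
first row to the end of the first column. -/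
def star (μ : YoungDiagram) : Set (ℕ × ℕ) := {x | x.2 < starRowLen μ x.1}

/-- The `n × n` array of boxes with north-west corner `(a, b)`. -/
def square (a b n : ℕ) : Set (ℕ × ℕ) :=
  {x | a ≤ x.1 ∧ x.1 < a + n ∧ b ≤ x.2 ∧ x.2 < b + n}

/-- `n` is the size of the largest square of `μ*` with north-west corner `(a, b)`. -/
def IsSquareSize (μ : YoungDiagram) (a b n : ℕ) : Prop :=
  IsGreatest {m : ℕ | 1 ≤ m ∧ square a b m ⊆ star μ} n

/-- `p` solves the determinantal system with parameters `θ`: on every maximal square of `μ*`, the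
determinant of the array of values of `p` is the parameter of the north-west corner. -/
def IsSolution {K : Type*} [Field K] (μ : YoungDiagram) (θ p : ℕ × ℕ → K) : Prop :=
  ∀ a b n : ℕ, (a, b) ∈ star μ → IsSquareSize μ a b n →
    (Matrix.of fun i j : Fin n => p (a + (i : ℕ), b + (j : ℕ))).det = θ (a, b)

/-- An oriented graph with weights on its edges. -/
structure Network (V K : Type*) where
  /-- `Edge u v`: there is an oriented edge from `u` to `v`. -/
  Edge : V → V → Prop
  /-- The weight of an edge. -/
  weight : V → V → K

namespace Network

variable {V K : Type*}

/-- The oriented paths from `u` to `v`, as the lists of the vertices visited. -/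
def paths (G : Network V K) (u v : V) : Set (List V) :=
  {l | l.IsChain G.Edge ∧ l.head? = some u ∧ l.getLast? = some v}

/-- The weight of a path: the product of the weights of its edges. -/
def pathWeight [Field K] (G : Network V K) (l : List V) : K :=
  (List.zipWith G.weight l l.tail).prod

/-- The partition function of paths from `u` to `v`: the sum of the weights of the paths. -/
noncomputable def partitionFunction [Field K] (G : Network V K) (u v : V) : K :=
  ∑ᶠ l ∈ G.paths u v, G.pathWeight l

end Network

/-- The sub-diagram of the boxes of `μ` weakly south-east of `(a, b)`. -/
def corner (μ : YoungDiagram) (a b : ℕ) : Set (ℕ × ℕ) :=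
  {x | x ∈ μ ∧ a ≤ x.1 ∧ b ≤ x.2}

/-- The oriented edges of the network: the sides of the boxes of the sub-diagram. Vertices are the
corners of boxes, the box `(i, j)` having the corners `(i, j)`, `(i, j + 1)`, `(i + 1, j)`,
`(i + 1, j + 1)`. When the diagram is tilted so that its north-west corner is on top, the
orientation from left to right directs horizontal sides to the east and vertical sides to the
north. -/
def IsBoxEdge (μ : YoungDiagram) (a b : ℕ) (u v : ℕ × ℕ) : Prop :=
  ∃ i j : ℕ, (i, j) ∈ corner μ a b ∧
    ((u = (i, j) ∧ v = (i, j + 1)) ∨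
     (u = (i + 1, j) ∧ v = (i + 1, j + 1)) ∨
     (u = (i + 1, j) ∧ v = (i, j)) ∨
     (u = (i + 1, j + 1) ∧ v = (i, j + 1)))

open Classical in
/-- The variable of the face north-west of the vertex `x`. The parameter `θ x` of the box `x` is
moved by one row up and one column to the left, from the box south-east of the vertex `x` to the
face north-west of it; the faces that receive no parameter carry the variable `1`. -/
noncomputable def faceNW {K : Type*} [Field K] (μ : YoungDiagram) (θ : ℕ × ℕ → K)
    (x : ℕ × ℕ) : K :=
  if x ∈ star μ then θ x else 1

/-- The variable of the face south-east of the vertex `x`. -/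
noncomputable def faceSE {K : Type*} [Field K] (μ : YoungDiagram) (θ : ℕ × ℕ → K)
    (x : ℕ × ℕ) : K :=
  faceNW μ θ (x.1 + 1, x.2 + 1)

/-- The weight of the edge from `u` to `v`. For a horizontal edge it is the ratio of the variables
of the faces north-west of `u` and of `v`, for a vertical edge the ratio of the variables of the
faces south-east of `u` and of `v`. -/
noncomputable def edgeWeight {K : Type*} [Field K] (μ : YoungDiagram) (θ : ℕ × ℕ → K)
    (u v : ℕ × ℕ) : K :=
  if u.1 = v.1 then faceNW μ θ u / faceNW μ θ v else faceSE μ θ u / faceSE μ θ v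

/-- The network of the sub-diagram of `μ` with north-west corner `(a, b)`. -/
noncomputable def network {K : Type*} [Field K] (μ : YoungDiagram) (θ : ℕ × ℕ → K) (a b : ℕ) :
    Network (ℕ × ℕ) K where
  Edge := IsBoxEdge μ a b
  weight := edgeWeight μ θ

/-- The leftmost vertex of the tilted network: the bottom end of column `b`. -/
def leftmost (μ : YoungDiagram) (b : ℕ) : ℕ × ℕ := (μ.colLen b, b)

/-- The rightmost vertex of the tilted network: the right end of row `a`. -/
def rightmost (μ : YoungDiagram) (a : ℕ) : ℕ × ℕ := (a, μ.rowLen a)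

end YoungNetwork

/-!
Write `t` for `faceNW μ θ`, that is `θ` extended by `1` outside the extended diagram `μ*`. If `μ` is
not empty, the vertices of its network are exactly the boxes of `μ*`. Let `F b (r, c)` be
the partition function of the paths from the leftmost vertex of column `b` to the vertex `(r, c)`, and rescale it to
`S b (r, c) = t (r, c) * F b (r, c)`. Removing the last edge of a path gives
`S b (r, c + 1) = S b (r, c) + y (r, c + 1) * S b (r + 1, c + 1)`, where the coefficient
`y (r, c)` (`stepCoeff`) does not depend on `b` and vanishes if `(r + 1, c)` is not in `μ*`. In
column `b` itself there is only one path, the weight of which telescopes to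
`S b (r, b) = t (r, b) / t (r + 1, b + 1)`. With these rules `S` makes sense for all `(r, c)`
(`sweep`), and the proposed solution is the value of `S b (a, c)` for `c` large, or equivalently
for `c = μ.rowLen a`.

Since the coefficients of the recursion are the same for all `b`, the recursion is a row operation
on the matrix with entries `S (b + j) (a + i, c)`: subtracting from each row a multiple of the next
one lowers `c` by `1` in all rows but the last. As long as `(a + n, c)` is outside `μ*`, the last
row does not change either, so that the determinant of a maximal square of size `n` may be computed
with `c = b + n - 1` (`det_sweepMatrix_of_notMem`). From there on each round of row operations
clears the last column above its bottom entry `t (r, c) / t (r + 1, c + 1)` on the diagonal, and the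
determinant is a product that telescopes to `t (a, b) / t (a + n, b + n)`
(`det_sweepMatrix_diag`); this is `θ (a, b)` when the square is maximal.

For uniqueness (`IsSolution.unique`), the coefficient of `p (a, b)` in its equation is the
determinant of the maximal square at `(a + 1, b + 1)`, which is a non-zero parameter (or `1`, if
`(a + 1, b + 1)` is outside `μ*`), so that the values of `p` are determined successively
from the south-east to the north-west.
-/

namespace YoungNetwork

/-! ### Last-step decomposition of paths -/

namespace Network

variable {V K : Type*}

theorem mem_paths_iff (G : Network V K) {u v : V} (huv : u ≠ v) (l : List V) :
    l ∈ G.paths u v ↔ ∃ w, G.Edge w v ∧ ∃ l' ∈ G.paths u w, l' ++ [v] = l := by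
  constructor
  · rintro ⟨hc, hh, hl⟩
    obtain ⟨l', rfl⟩ := List.getLast?_eq_some_iff.1 hl
    rcases List.eq_nil_or_concat l' with rfl | ⟨l'', w, rfl⟩
    · simp only [List.nil_append, List.head?_cons, Option.some.injEq] at hh
      exact absurd hh.symm huv
    · rw [List.isChain_append] at hc
      refine ⟨w, hc.2.2 w (by simp) v (by simp), _, ⟨hc.1, ?_, by simp⟩, rfl⟩
      simpa [List.head?_append] using hh
  · rintro ⟨w, hw, l', ⟨hc, hh, hl⟩, rfl⟩
    refine ⟨?_, ?_, by simp⟩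
    · rw [List.isChain_append]
      refine ⟨hc, by simp, fun x hx y hy => ?_⟩
      rw [hl] at hx
      simp only [Option.mem_def, Option.some.injEq, List.head?_cons] at hx hy
      subst hx hy
      exact hw
    · rw [List.head?_append, hh]; rfl

theorem paths_self (G : Network V K) {u : V} (hu : ∀ w, ¬ G.Edge w u) :
    G.paths u u = {[u]} := by
  ext l
  constructor
  · rintro ⟨hc, hh, hl⟩
    obtain ⟨l', rfl⟩ := List.getLast?_eq_some_iff.1 hl
    rcases List.eq_nil_or_concat l' with rfl | ⟨l'', w, rfl⟩
    · rfl
    · rw [List.isChain_append] at hc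
      exact absurd (hc.2.2 w (by simp) u (by simp)) (hu w)
  · rintro rfl
    exact ⟨by simp, by simp, by simp⟩

variable [Field K]

theorem pathWeight_append_singleton (G : Network V K) {l : List V} {w : V}
    (hl : l.getLast? = some w) (v : V) :
    G.pathWeight (l ++ [v]) = G.pathWeight l * G.weight w v := by
  induction l with
  | nil => simp at hl
  | cons x t ih =>
    cases t with
    | nil =>
      simp only [List.getLast?_singleton, Option.some.injEq] at hl
      subst hl
      simp [pathWeight]
    | cons y t =>
      have := ih (by simpa using hl)
      simp only [pathWeight, List.cons_append, List.tail_cons, List.zipWith_cons_cons,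
        List.prod_cons] at this ⊢
      rw [this, mul_assoc]

theorem partitionFunction_self (G : Network V K) {u : V} (hu : ∀ w, ¬ G.Edge w u) :
    G.partitionFunction u u = 1 := by
  rw [partitionFunction, paths_self G hu, finsum_mem_singleton]
  simp [pathWeight]

/-- Last-step decomposition: a path to `v` of positive length consists of a path to one of the
predecessors of `v` and one further edge. -/
theorem paths_last_step (G : Network V K) {u v : V} (huv : u ≠ v) (s : Finset V)
    (hs : ∀ w, w ∈ s ↔ G.Edge w v) (hfin : ∀ w ∈ s, (G.paths u w).Finite) :
    (G.paths u v).Finite ∧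
      G.partitionFunction u v = ∑ w ∈ s, G.partitionFunction u w * G.weight w v := by
  have hinj : Function.Injective fun l : List V => l ++ [v] := List.append_left_injective [v]
  have hU : G.paths u v = ⋃ w ∈ (s : Set V), (fun l => l ++ [v]) '' G.paths u w := by
    ext l
    simp only [G.mem_paths_iff huv, Set.mem_iUnion, Set.mem_image, Finset.mem_coe, hs, exists_prop]
  have hfin' : ∀ w ∈ (s : Set V), ((fun l => l ++ [v]) '' G.paths u w).Finite :=
    fun w hw => (hfin w hw).image _
  refine ⟨hU ▸ s.finite_toSet.biUnion hfin', ?_⟩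
  rw [partitionFunction, hU, finsum_mem_biUnion _ s.finite_toSet hfin', finsum_mem_coe_finset]
  · refine Finset.sum_congr rfl fun w hw => ?_
    rw [finsum_mem_image hinj.injOn, partitionFunction, finsum_mem_mul]
    exact finsum_mem_congr rfl fun l hl => G.pathWeight_append_singleton hl.2.2 v
  · intro w _ w' _ hne
    refine Set.disjoint_left.2 ?_
    rintro _ ⟨l, hl, rfl⟩ ⟨l', hl', h⟩
    obtain rfl := hinj h
    exact hne (Option.some.inj (hl.2.2.symm.trans hl'.2.2))

end Network

/-! ### The extended diagram -/

theorem mem_star_zero_left {μ : YoungDiagram} {c : ℕ} : (0, c) ∈ star μ ↔ c ≤ μ.rowLen 0 := by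
  simp [star, starRowLen]

theorem mem_star_succ {μ : YoungDiagram} {r c : ℕ} :
    (r + 1, c) ∈ star μ ↔ r < μ.colLen 0 ∧ c ≤ μ.rowLen r := by
  by_cases h : r < μ.colLen 0 <;> simp [star, starRowLen, h]

theorem mem_star_succ_succ {μ : YoungDiagram} {r c : ℕ} :
    (r + 1, c + 1) ∈ star μ ↔ (r, c) ∈ μ := by
  rw [mem_star_succ, ← YoungDiagram.mem_iff_lt_colLen, Nat.succ_le_iff,
    ← YoungDiagram.mem_iff_lt_rowLen]
  exact ⟨fun h => h.2, fun h => ⟨μ.up_left_mem le_rfl (Nat.zero_le _) h, h⟩⟩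

/-- The extended diagram is again a Young diagram. -/
theorem star_lower {μ : YoungDiagram} {r c r' c' : ℕ} (hr : r' ≤ r) (hc : c' ≤ c)
    (h : (r, c) ∈ star μ) : (r', c') ∈ star μ := by
  have hanti : Antitone (starRowLen μ) := by
    refine antitone_nat_of_succ_le fun i => ?_
    cases i with
    | zero => by_cases h : 0 < μ.colLen 0 <;> simp [starRowLen, h]
    | succ i =>
      have := μ.rowLen_anti i (i + 1) (Nat.le_succ i)
      by_cases h : i + 1 < μ.colLen 0
      · simp [starRowLen, h, Nat.lt_of_succ_lt h, this]
      · simp [starRowLen, h]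
  exact hc.trans_lt (lt_of_lt_of_le h (hanti hr))

theorem star_bound {μ : YoungDiagram} {r c : ℕ} (h : (r, c) ∈ star μ) :
    r ≤ μ.colLen 0 ∧ c ≤ μ.rowLen 0 := by
  refine ⟨?_, mem_star_zero_left.1 (star_lower (Nat.zero_le _) le_rfl h)⟩
  cases r with
  | zero => exact Nat.zero_le _
  | succ r => exact (mem_star_succ.1 h).1

theorem square_subset_star_iff {μ : YoungDiagram} {a b n : ℕ} :
    square a b (n + 1) ⊆ star μ ↔ (a + n, b + n) ∈ star μ := by
  constructor
  · intro h
    apply h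
    simp only [square, Set.mem_ofPred_eq]
    omega
  · rintro h ⟨i, j⟩ ⟨_, hi, _, hj⟩
    simp only at hi hj
    exact star_lower (by omega) (by omega) h

/-- The size of the largest square at `(a, b)` is the number of boxes of `μ*` on the diagonal
going south-east from `(a, b)`. -/
theorem isSquareSize_succ_iff {μ : YoungDiagram} {a b n : ℕ} :
    IsSquareSize μ a b (n + 1) ↔ (a + n, b + n) ∈ star μ ∧ (a + n + 1, b + n + 1) ∉ star μ := by
  constructor
  · rintro ⟨⟨_, h⟩, hmax⟩
    refine ⟨square_subset_star_iff.1 h, fun h' => ?_⟩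
    have := hmax (show n + 2 ∈ _ from ⟨by omega, square_subset_star_iff.2 h'⟩)
    omega
  · rintro ⟨h, h'⟩
    refine ⟨⟨by omega, square_subset_star_iff.2 h⟩, ?_⟩
    rintro (_ | m) ⟨hm, hsub⟩
    · omega
    · by_contra hlt
      exact h' (star_lower (by omega) (by omega) (square_subset_star_iff.1 hsub))

theorem exists_isSquareSize {μ : YoungDiagram} {a b : ℕ} (h : (a, b) ∈ star μ) :
    ∃ n, IsSquareSize μ a b (n + 1) := by
  classical
  have hex : ∃ n, (a + n + 1, b + n + 1) ∉ star μ :=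
    ⟨μ.colLen 0, fun h' => by have := (star_bound h').1; omega⟩
  refine ⟨Nat.find hex, isSquareSize_succ_iff.2 ⟨?_, Nat.find_spec hex⟩⟩
  rcases hn : Nat.find hex with _ | k
  · exact h
  · exact not_not.1 (Nat.find_min hex (show k < Nat.find hex by omega))

variable {K : Type*} [Field K]

/-! ### Uniqueness -/

theorem det_sub_det_of_eq_off_corner {n : ℕ} (A B : Matrix (Fin (n + 1)) (Fin (n + 1)) K)
    (h : ∀ i j, (i, j) ≠ (0, 0) → A i j = B i j) :
    A.det - B.det = (A 0 0 - B 0 0) * (B.submatrix Fin.succ Fin.succ).det := by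
  rw [Matrix.det_succ_row_zero A, Matrix.det_succ_row_zero B, ← Finset.sum_sub_distrib,
    Fin.sum_univ_succ, Finset.sum_eq_zero]
  · have : A.submatrix Fin.succ Fin.succ = B.submatrix Fin.succ Fin.succ := by
      ext i j
      exact h _ _ (by simp)
    simp [Fin.succAbove_zero, this]
    ring
  · intro j _
    have : A.submatrix Fin.succ j.succ.succAbove = B.submatrix Fin.succ j.succ.succAbove := by
      ext i k
      exact h _ _ (by simp)
    rw [this, h 0 j.succ (by simp), sub_self]

/-- A solution is determined box by box, starting from the south-east: the coefficient of `p (a, b)`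
in the equation at `(a, b)` is the left-hand side of the equation at `(a + 1, b + 1)`. -/
theorem IsSolution.unique {μ : YoungDiagram} {θ p q : ℕ × ℕ → K}
    (hθ : ∀ x ∈ star μ, θ x ≠ 0) (hp : IsSolution μ θ p) (hq : IsSolution μ θ q) :
    ∀ x ∈ star μ, q x = p x := by
  suffices H : ∀ k a b, μ.colLen 0 + μ.rowLen 0 < a + b + k → (a, b) ∈ star μ →
      q (a, b) = p (a, b) from
    fun x hx => H (μ.colLen 0 + μ.rowLen 0 + 1) x.1 x.2 (by omega) hx
  intro k
  induction k with
  | zero =>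
    intro a b hk h
    have := star_bound h
    omega
  | succ k ih =>
    intro a b hk h
    obtain ⟨n, hn⟩ := exists_isSquareSize h
    have hn' := isSquareSize_succ_iff.1 hn
    have key := det_sub_det_of_eq_off_corner
      (Matrix.of fun i j : Fin (n + 1) => q (a + (i : ℕ), b + (j : ℕ)))
      (Matrix.of fun i j : Fin (n + 1) => p (a + (i : ℕ), b + (j : ℕ))) (by
        intro i j hij
        have hij' : 0 < (i : ℕ) + j := by
          rw [Nat.pos_iff_ne_zero]
          intro h0
          exact hij (Prod.ext (Fin.ext (by change (i : ℕ) = 0; omega))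
            (Fin.ext (by change (j : ℕ) = 0; omega)))
        exact ih _ _ (by omega) (star_lower (by omega) (by omega) hn'.1))
    rw [hq a b _ h hn, hp a b _ h hn, sub_self] at key
    have hminor : (Matrix.submatrix
        (Matrix.of fun i j : Fin (n + 1) => p (a + (i : ℕ), b + (j : ℕ)))
        Fin.succ Fin.succ).det ≠ 0 := by
      cases n with
      | zero => simp
      | succ n =>
        have h1 : (a + 1, b + 1) ∈ star μ := star_lower (by omega) (by omega) hn'.1
        have hθ' := hθ _ h1
        have := hp (a + 1) (b + 1) (n + 1) h1 (isSquareSize_succ_iff.2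
          (by simpa [add_assoc, add_comm, add_left_comm] using hn'))
        rw [← this] at hθ'
        convert hθ' using 2
        ext i j
        simp [add_comm, add_left_comm]
    have := (mul_eq_zero.1 key.symm).resolve_right hminor
    simpa [sub_eq_zero] using this

/-! ### Two determinant lemmas -/

/-- Adding to each row a multiple of the next row does not change the determinant. -/
theorem det_eq_of_forall_row_eq_add_smul_succ {n : ℕ}
    {A B : Matrix (Fin (n + 1)) (Fin (n + 1)) K} (y : Fin n → K)
    (hlast : ∀ j, A (Fin.last n) j = B (Fin.last n) j)
    (hrow : ∀ (i : Fin n) (j), A i.castSucc j = B i.castSucc j + y i * A i.succ j) :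
    A.det = B.det := by
  rw [← Matrix.det_submatrix_equiv_self Fin.revPerm A,
    ← Matrix.det_submatrix_equiv_self Fin.revPerm B]
  refine Matrix.det_eq_of_forall_row_eq_smul_add_pred (fun i => y i.rev) (fun j => ?_)
    fun i j => ?_
  · simpa using hlast j.rev
  · simpa [Fin.rev_succ, Fin.rev_castSucc] using hrow i.rev j.rev

theorem det_of_last_col_eq_zero {n : ℕ} (A : Matrix (Fin (n + 1)) (Fin (n + 1)) K)
    (h : ∀ i : Fin n, A i.castSucc (Fin.last n) = 0) :
    A.det = A (Fin.last n) (Fin.last n) * (A.submatrix Fin.castSucc Fin.castSucc).det := by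
  rw [Matrix.det_succ_column A (Fin.last n), Fin.sum_univ_castSucc, Finset.sum_eq_zero]
  · have hs : (Fin.last n).succAbove = Fin.castSucc := by
      ext i
      simp
    rw [hs]
    simp [← two_mul]
  · intro i _
    simp [h i]

/-! ### The rescaled partition functions -/

open Classical in
/-- The coefficient of a vertical last step `(r + 1, c) → (r, c)` in the recursion for partition
functions rescaled by the variable of the face north-west of the end point. It is `0` if
`(r + 1, c)` is not a vertex of the network, so that there is no such step. -/
noncomputable def stepCoeff (μ : YoungDiagram) (θ : ℕ × ℕ → K) (r c : ℕ) : K :=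
  if (r + 1, c) ∈ star μ then
    faceNW μ θ (r + 2, c + 1) * faceNW μ θ (r, c) /
      (faceNW μ θ (r + 1, c + 1) * faceNW μ θ (r + 1, c))
  else 0

open Classical in
/-- The partition function of the paths from the leftmost vertex of column `b` to `(r, c)`, times
the variable of the face north-west of `(r, c)`, as the solution of the last-step recursion. It is
defined for all `(r, c)`, also where it is no partition function of the network; to the east of the
end of row `r` of `μ` it is constant in `c`.
The test for `(r + 1, c) ∈ star μ` only makes the recursion terminate, since `stepCoeff` vanishes
otherwise. -/
noncomputable def sweep (μ : YoungDiagram) (θ : ℕ × ℕ → K) (b : ℕ) (r c : ℕ) : K :=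
  if c < b then 0
  else if c = b then faceNW μ θ (r, b) / faceNW μ θ (r + 1, b + 1)
  else sweep μ θ b r (c - 1) +
    if (r + 1, c) ∈ star μ then stepCoeff μ θ r c * sweep μ θ b (r + 1) c else 0
termination_by (μ.colLen 0 + 1 - r, c)
decreasing_by
  · exact Prod.Lex.right _ (by omega)
  · rename_i h
    have := (star_bound h).1
    exact Prod.Lex.left _ _ (by omega)

variable {μ : YoungDiagram} {θ : ℕ × ℕ → K}

theorem sweep_of_lt {b r c : ℕ} (h : c < b) : sweep μ θ b r c = 0 := by
  rw [sweep, if_pos h]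

theorem sweep_self (b r : ℕ) :
    sweep μ θ b r b = faceNW μ θ (r, b) / faceNW μ θ (r + 1, b + 1) := by
  rw [sweep, if_neg (lt_irrefl b), if_pos rfl]

theorem stepCoeff_of_notMem {r c : ℕ} (h : (r + 1, c) ∉ star μ) : stepCoeff μ θ r c = 0 :=
  if_neg h

theorem sweep_succ {b c : ℕ} (h : b ≤ c) (r : ℕ) :
    sweep μ θ b r (c + 1) =
      sweep μ θ b r c + stepCoeff μ θ r (c + 1) * sweep μ θ b (r + 1) (c + 1) := by
  rw [sweep, if_neg (by omega), if_neg (by omega), Nat.add_sub_cancel]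
  by_cases hm : (r + 1, c + 1) ∈ star μ
  · rw [if_pos hm]
  · rw [if_neg hm, stepCoeff_of_notMem hm, zero_mul]

theorem faceNW_ne_zero (hθ : ∀ x ∈ star μ, θ x ≠ 0) (x : ℕ × ℕ) : faceNW μ θ x ≠ 0 := by
  by_cases h : x ∈ star μ
  · simpa [faceNW, h] using hθ x h
  · simp [faceNW, h]

/-- The last-step recursion persists at `c = b`, where the horizontal term is zero. -/
theorem sweep_self_eq_stepCoeff_mul (hθ : ∀ x ∈ star μ, θ x ≠ 0) {b r : ℕ}
    (h : (r + 1, b) ∈ star μ) :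
    sweep μ θ b r b = stepCoeff μ θ r b * sweep μ θ b (r + 1) b := by
  rw [sweep_self, sweep_self, stepCoeff, if_pos h]
  have h1 := faceNW_ne_zero hθ (r + 1, b + 1)
  have h2 := faceNW_ne_zero hθ (r + 1, b)
  have h3 := faceNW_ne_zero hθ (r + 2, b + 1)
  rw [show r + 1 + 1 = r + 2 from rfl]
  field_simp

/-! ### Determinants of squares -/

/-- The rescaled partition functions from the leftmost vertices of the columns `b, …, b + n - 1` to
the end points in column `c` of the rows `a, …, a + n - 1`. -/
noncomputable def sweepMatrix (μ : YoungDiagram) (θ : ℕ × ℕ → K) (a b c n : ℕ) :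
    Matrix (Fin n) (Fin n) K :=
  Matrix.of fun i j => sweep μ θ (b + (j : ℕ)) (a + (i : ℕ)) c

/-- The determinant with end points in the last column `b + n` of the square is a telescoping
product along the diagonal. -/
theorem det_sweepMatrix_diag (hθ : ∀ x ∈ star μ, θ x ≠ 0) (a b n : ℕ)
    (h : (a + n, b + n) ∈ star μ) :
    (sweepMatrix μ θ a b (b + n) (n + 1)).det =
      faceNW μ θ (a, b) / faceNW μ θ (a + n + 1, b + n + 1) := by
  induction n with
  | zero => simp [sweepMatrix, sweep_self]
  | succ n ih =>
    -- `B` is the result of one round of row operations: the end points of all rows but the last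
    -- have moved one column to the west.
    let B : Matrix (Fin (n + 2)) (Fin (n + 2)) K := Matrix.of fun i j =>
      if i = Fin.last (n + 1) then sweep μ θ (b + (j : ℕ)) (a + (i : ℕ)) (b + (n + 1))
      else sweep μ θ (b + (j : ℕ)) (a + (i : ℕ)) (b + n)
    have hB : (sweepMatrix μ θ a b (b + (n + 1)) (n + 2)).det = B.det := by
      refine det_eq_of_forall_row_eq_add_smul_succ
        (fun i => stepCoeff μ θ (a + i) (b + (n + 1))) (fun j => by simp [B, sweepMatrix])
        fun i j => ?_
      simp only [sweepMatrix, B, Matrix.of_apply, Fin.val_castSucc, Fin.val_succ,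
        Fin.castSucc_ne_last, if_false]
      rcases (Nat.lt_succ_iff.1 j.2).lt_or_eq with hj | hj
      · exact sweep_succ (show b + (j : ℕ) ≤ b + n by omega) _
      · rw [hj, sweep_of_lt (show b + n < b + (n + 1) by omega), zero_add]
        exact sweep_self_eq_stepCoeff_mul hθ (star_lower (by omega) le_rfl h)
    have hsub : B.submatrix Fin.castSucc Fin.castSucc = sweepMatrix μ θ a b (b + n) (n + 1) := by
      ext i j
      simp [B, sweepMatrix]
    rw [hB, det_of_last_col_eq_zero, hsub, ih (star_lower (by omega) (by omega) h)]
    · have h1 := faceNW_ne_zero hθ (a + n + 1, b + n + 1)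
      have h2 := faceNW_ne_zero hθ (a + (n + 1) + 1, b + (n + 1) + 1)
      simp only [B, Matrix.of_apply, if_true, Fin.val_last, sweep_self, ← add_assoc] at h2 ⊢
      field_simp
    · intro i
      simp only [B, Matrix.of_apply, Fin.castSucc_ne_last, if_false, Fin.val_last]
      exact sweep_of_lt (by omega)

/-- If the diagonal of the square cannot be extended in `μ*`, then the end points may be moved to
the east without a change of the determinant. -/
theorem det_sweepMatrix_of_notMem (a b n k : ℕ) (h : (a + n + 1, b + n + 1) ∉ star μ) :
    (sweepMatrix μ θ a b (b + n + k) (n + 1)).det = (sweepMatrix μ θ a b (b + n) (n + 1)).det := by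
  induction k with
  | zero => rfl
  | succ k ih =>
    rw [← ih]
    refine det_eq_of_forall_row_eq_add_smul_succ
      (fun i => stepCoeff μ θ (a + i) (b + n + k + 1)) (fun j => ?_) fun i j => ?_
    · have hm : (a + n + 1, b + n + k + 1) ∉ star μ :=
        fun h' => h (star_lower le_rfl (by omega) h')
      simp only [sweepMatrix, Matrix.of_apply, Fin.val_last, ← add_assoc]
      rw [sweep_succ (by omega), stepCoeff_of_notMem hm, zero_mul, add_zero]
    · simp only [sweepMatrix, Matrix.of_apply, Fin.val_castSucc, Fin.val_succ]
      exact sweep_succ (show b + (j : ℕ) ≤ b + n + k by omega) _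

/-- The solution of the determinantal system. No row of `μ*` goes beyond column `μ.rowLen 0`, where
`sweep` has become constant. -/
noncomputable def solution (μ : YoungDiagram) (θ : ℕ × ℕ → K) (x : ℕ × ℕ) : K :=
  sweep μ θ x.2 x.1 (μ.rowLen 0)

theorem isSolution_solution (hθ : ∀ x ∈ star μ, θ x ≠ 0) : IsSolution μ θ (solution μ θ) := by
  rintro a b (_ | n) hab hn
  · exact absurd hn.1.1 (by omega)
  · obtain ⟨hmem, hnot⟩ := isSquareSize_succ_iff.1 hn
    obtain ⟨k, hk⟩ := Nat.exists_eq_add_of_le (star_bound hmem).2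
    calc _ = (sweepMatrix μ θ a b (b + n + k) (n + 1)).det := by rw [← hk]; rfl
      _ = faceNW μ θ (a, b) / faceNW μ θ (a + n + 1, b + n + 1) := by
        rw [det_sweepMatrix_of_notMem a b n k hnot, det_sweepMatrix_diag hθ a b n hmem]
      _ = θ (a, b) := by simp [faceNW, hab, hnot]

/-! ### The partition functions of the network -/

/-- The edges into `(r, c)`: a horizontal edge is the top or the bottom side of a box, a vertical
one the left or the right side. -/
theorem isBoxEdge_iff {a b r c : ℕ} {u : ℕ × ℕ} :
    IsBoxEdge μ a b u (r, c) ↔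
      (∃ j, c = j + 1 ∧ u = (r, j) ∧
        ((r, j) ∈ corner μ a b ∨ ∃ i, r = i + 1 ∧ (i, j) ∈ corner μ a b)) ∨
      (u = (r + 1, c) ∧ ((r, c) ∈ corner μ a b ∨ ∃ j, c = j + 1 ∧ (r, j) ∈ corner μ a b)) := by
  constructor
  · rintro ⟨i, j, hm, ⟨rfl, h⟩ | ⟨rfl, h⟩ | ⟨rfl, h⟩ | ⟨rfl, h⟩⟩ <;>
      obtain ⟨rfl, rfl⟩ := Prod.mk.inj h
    · exact Or.inl ⟨j, rfl, rfl, Or.inl hm⟩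
    · exact Or.inl ⟨j, rfl, rfl, Or.inr ⟨i, rfl, hm⟩⟩
    · exact Or.inr ⟨rfl, Or.inl hm⟩
    · exact Or.inr ⟨rfl, Or.inr ⟨j, rfl, hm⟩⟩
  · rintro (⟨j, rfl, rfl, hm | ⟨i, rfl, hm⟩⟩ | ⟨rfl, hm | ⟨j, rfl, hm⟩⟩)
    · exact ⟨r, j, hm, by simp⟩
    · exact ⟨i, j, hm, by simp⟩
    · exact ⟨r, c, hm, by simp⟩
    · exact ⟨r, j, hm, by simp⟩

theorem isBoxEdge_first_col_iff {a b r : ℕ} (ha : a ≤ r) {u : ℕ × ℕ} :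
    IsBoxEdge μ a b u (r, b) ↔ u = (r + 1, b) ∧ r < μ.colLen b := by
  rw [isBoxEdge_iff, ← YoungDiagram.mem_iff_lt_colLen]
  constructor
  · rintro (⟨j, rfl, -, ⟨-, -, h⟩ | ⟨i, -, -, -, h⟩⟩ | ⟨rfl, h | ⟨j, rfl, -, -, h⟩⟩)
    · exact absurd h (by simp)
    · exact absurd h (by simp)
    · exact ⟨rfl, h.1⟩
    · exact absurd h (by simp)
  · rintro ⟨rfl, h⟩
    exact Or.inr ⟨rfl, Or.inl ⟨h, ha, le_rfl⟩⟩

/-- To the east of column `b`, a vertex always has an incoming horizontal edge, and it has an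
incoming vertical edge exactly if the box of `μ*` below is present. -/
theorem isBoxEdge_succ_iff {a b r c : ℕ} (ha : a ≤ r) (hb : b ≤ c) (hc : c < μ.rowLen a)
    (hstar : (r, c + 1) ∈ star μ) {u : ℕ × ℕ} :
    IsBoxEdge μ a b u (r, c + 1) ↔
      u = (r, c) ∨ (u = (r + 1, c + 1) ∧ (r + 1, c + 1) ∈ star μ) := by
  rw [isBoxEdge_iff, mem_star_succ_succ]
  constructor
  · rintro (⟨j, h, rfl, -⟩ | ⟨rfl, ⟨h, -⟩ | ⟨j, h, hm, -⟩⟩)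
    · obtain rfl : c = j := by omega
      exact Or.inl rfl
    · exact Or.inr ⟨rfl, μ.up_left_mem le_rfl (Nat.le_succ c) h⟩
    · obtain rfl : c = j := by omega
      exact Or.inr ⟨rfl, hm⟩
  · rintro (rfl | ⟨rfl, h⟩)
    · refine Or.inl ⟨c, rfl, rfl, ?_⟩
      rcases ha.eq_or_lt with rfl | hlt
      · exact Or.inl ⟨YoungDiagram.mem_iff_lt_rowLen.2 hc, le_rfl, hb⟩
      · obtain ⟨i, rfl⟩ := Nat.exists_eq_succ_of_ne_zero (Nat.ne_zero_of_lt hlt)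
        exact Or.inr ⟨i, rfl, mem_star_succ_succ.1 hstar, Nat.lt_succ_iff.1 hlt, hb⟩
    · exact Or.inr ⟨rfl, Or.inr ⟨c, rfl, h, ha, hb⟩⟩

/-- There are finitely many paths to `(r, c)`, and their rescaled partition function is `sweep`. The
bounds on `(r, c)` describe the vertices of the network of the sub-diagram at `(a, b)` in the rows
down to its leftmost vertex. -/
theorem finite_paths_and_faceNW_mul_partitionFunction
    (hθ : ∀ x ∈ star μ, θ x ≠ 0) {a b : ℕ} :
    ∀ r c, a ≤ r → r ≤ μ.colLen b → b ≤ c → c ≤ μ.rowLen a → (r, c) ∈ star μ →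
      ((network μ θ a b).paths (leftmost μ b) (r, c)).Finite ∧
      faceNW μ θ (r, c) * (network μ θ a b).partitionFunction (leftmost μ b) (r, c) =
        sweep μ θ b r c := by
  have hne := faceNW_ne_zero hθ
  -- Induction from the bottom row upwards, and from west to east within each row.
  suffices H : ∀ k r c, μ.colLen b < r + k → a ≤ r → r ≤ μ.colLen b → b ≤ c → c ≤ μ.rowLen a →
      (r, c) ∈ star μ →
      ((network μ θ a b).paths (leftmost μ b) (r, c)).Finite ∧
      faceNW μ θ (r, c) * (network μ θ a b).partitionFunction (leftmost μ b) (r, c) =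
        sweep μ θ b r c from
    fun r c => H (μ.colLen b + 1) r c (by omega)
  intro k
  induction k with
  | zero => intros; omega
  | succ k ih =>
    intro r c hk ha hr hb
    induction c, hb using Nat.le_induction with
    | base =>
      intro hc hstar
      rcases hr.eq_or_lt with rfl | hlt
      · have hnone : ∀ w, ¬ (network μ θ a b).Edge w (leftmost μ b) :=
          fun w hw => lt_irrefl _ ((isBoxEdge_first_col_iff ha).1 hw).2
        -- The face south-east of the leftmost vertex carries the variable `1`.
        have hout : (μ.colLen b + 1, b + 1) ∉ star μ := by
          rw [mem_star_succ_succ, YoungDiagram.mem_iff_lt_colLen]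
          exact lt_irrefl _
        refine ⟨?_, ?_⟩
        · rw [← leftmost, Network.paths_self _ hnone]
          exact Set.finite_singleton _
        · rw [← leftmost, Network.partitionFunction_self _ hnone, leftmost, sweep_self]
          simp [faceNW, hout]
      · have hmem : (r + 1, b) ∈ star μ :=
          star_lower le_rfl (Nat.le_succ b)
            (mem_star_succ_succ.2 (YoungDiagram.mem_iff_lt_colLen.2 hlt))
        obtain ⟨hfin, hF⟩ := ih (r + 1) b (by omega) (by omega) hlt le_rfl hc hmem
        obtain ⟨h1, h2⟩ := (network μ θ a b).paths_last_step (u := leftmost μ b) (v := (r, b))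
          (by simp [leftmost, hlt.ne']) {(r + 1, b)}
          (fun w => by
            rw [Finset.mem_singleton]
            exact ((isBoxEdge_first_col_iff ha).trans (and_iff_left hlt)).symm)
          (by simpa using hfin)
        refine ⟨h1, ?_⟩
        rw [sweep_self] at hF ⊢
        rw [mul_comm, ← eq_div_iff (hne _)] at hF
        rw [h2, Finset.sum_singleton, hF]
        have e1 := hne (r + 1 + 1, b + 1)
        have e2 := hne (r + 1, b + 1)
        have e3 := hne (r + 1, b)
        simp only [network, edgeWeight, faceSE, Nat.succ_ne_self, if_false]
        field_simp
    | succ c hbc ihc =>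
      intro hc hstar
      obtain ⟨hfin, hF⟩ := ihc (by omega) (star_lower le_rfl (Nat.le_succ c) hstar)
      have hv : leftmost μ b ≠ (r, c + 1) := fun h => by
        have := (Prod.mk.inj h).2
        omega
      have hedge := fun w => isBoxEdge_succ_iff (u := w) ha hbc hc hstar
      rw [sweep_succ hbc]
      by_cases hmem : (r + 1, c + 1) ∈ star μ
      · have hr' : r < μ.colLen b := YoungDiagram.mem_iff_lt_colLen.1
          (μ.up_left_mem le_rfl hbc (mem_star_succ_succ.1 hmem))
        obtain ⟨hfin', hF'⟩ := ih (r + 1) (c + 1) (by omega) (by omega) hr' (by omega) hc hmem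
        obtain ⟨h1, h2⟩ := (network μ θ a b).paths_last_step hv {(r, c), (r + 1, c + 1)}
          (fun w => by
            rw [Finset.mem_insert, Finset.mem_singleton]
            exact ((hedge w).trans (or_congr_right (and_iff_left hmem))).symm)
          (by simpa using ⟨hfin, hfin'⟩)
        refine ⟨h1, ?_⟩
        rw [h2, Finset.sum_pair (by simp), ← hF, ← hF', stepCoeff, if_pos hmem]
        have e1 := hne (r, c + 1)
        have e2 := hne (r + 1, c + 2)
        have e3 := hne (r + 1, c + 1)
        simp only [network, edgeWeight, faceSE, Nat.succ_ne_self, if_false, if_true, add_assoc,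
          Nat.reduceAdd]
        field_simp
      · obtain ⟨h1, h2⟩ := (network μ θ a b).paths_last_step hv {(r, c)}
          (fun w => by
            rw [Finset.mem_singleton]
            exact ((hedge w).trans (by simp [hmem])).symm)
          (by simpa using hfin)
        refine ⟨h1, ?_⟩
        rw [h2, Finset.sum_singleton, ← hF, stepCoeff_of_notMem hmem]
        have e1 := hne (r, c + 1)
        simp only [network, edgeWeight, if_true]
        field_simp
        simp

theorem sweep_eq_of_rowLen_le {a b c : ℕ} (hb : b ≤ μ.rowLen a) (hc : μ.rowLen a ≤ c) :
    sweep μ θ b a c = sweep μ θ b a (μ.rowLen a) := by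
  induction c, hc using Nat.le_induction with
  | base => rfl
  | succ c hc ih =>
    have hnot : (a + 1, c + 1) ∉ star μ := by
      rw [mem_star_succ_succ, YoungDiagram.mem_iff_lt_rowLen]
      omega
    rw [sweep_succ (hb.trans hc), stepCoeff_of_notMem hnot, zero_mul, add_zero, ih]

end YoungNetwork

open YoungNetwork in
theorem theorem4 {K : Type*} [Field K] (μ : YoungDiagram) (θ : ℕ × ℕ → K)
    (hθ : ∀ x ∈ YoungNetwork.star μ, θ x ≠ 0) :
    ∃ p : ℕ × ℕ → K, YoungNetwork.IsSolution μ θ p ∧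
      (∀ q : ℕ × ℕ → K, YoungNetwork.IsSolution μ θ q →
        ∀ x ∈ YoungNetwork.star μ, q x = p x) ∧
      ∀ a b : ℕ, (a, b) ∈ μ →
        ((YoungNetwork.network μ θ a b).paths
          (YoungNetwork.leftmost μ b) (YoungNetwork.rightmost μ a)).Finite ∧
        p (a, b) = θ (a, μ.rowLen a) *
          (YoungNetwork.network μ θ a b).partitionFunction
            (YoungNetwork.leftmost μ b) (YoungNetwork.rightmost μ a) := by
  refine ⟨solution μ θ, isSolution_solution hθ,
    fun q hq => (isSolution_solution hθ).unique hθ hq, fun a b hab => ?_⟩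
  have hb : b ≤ μ.rowLen a := (YoungDiagram.mem_iff_lt_rowLen.1 hab).le
  have hmem : (a, μ.rowLen a) ∈ star μ := by
    cases a with
    | zero => exact mem_star_zero_left.2 le_rfl
    | succ a =>
      exact mem_star_succ.2 ⟨YoungDiagram.mem_iff_lt_colLen.1
        (μ.up_left_mem (Nat.le_succ a) (Nat.zero_le b) hab), μ.rowLen_anti _ _ (Nat.le_succ a)⟩
  obtain ⟨hfin, hF⟩ := finite_paths_and_faceNW_mul_partitionFunction hθ a (μ.rowLen a) le_rfl
    (YoungDiagram.mem_iff_lt_colLen.1 hab).le hb le_rfl hmem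
  refine ⟨hfin, ?_⟩
  rw [solution, sweep_eq_of_rowLen_le hb (μ.rowLen_anti _ _ (Nat.zero_le a)), ← hF, faceNW,
    if_pos hmem, rightmost]
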